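/- Let $\mathbb{A}$ be a countably infinite set (of atoms). Let the class of polynomial orbit-finite sets be the smallest class of sets, equipped with an action of the group of permutations of $\mathbb{A}$, that contains the singleton $1$ with the trivial action and $\mathbb{A}$ with the natural action, and is closed under binary products $X\times Y$ and disjoint sums $X+Y$ (with the componentwise actions). A function $f:X\to Y$ between such sets is finitely supported if there is a finite $\alpha\subset\mathbb{A}$ such that $\pi\circ f\circ\pi^{-1}=f$ for every permutation $\pi$ of $\mathbb{A}$ that fixes all elements of $\alpha$. The single-use functions form the smallest class of functions between polynomial orbit-finite sets that is closed under composition $g\circ f$, products $f\times g:X_1\times X_2\to Y_1\times Y_2$ and sums $f+g:X_1+X_2\to Y_1+Y_2$, and contains the following basic functions, for all polynomial orbit-finite $X,Y,Z$: the equality test $\mathtt{eq}:\mathbb{A}\times\mathbb{A}\to 1+1$, the constants $\mathtt{const}_a:1\to\mathbb{A}$ for $a\in\mathbb{A}$, the identity on $\mathbb{A}$; the projections $X\times Y\to X$ and $X\times Y\to Y$, the natural bijections $X\times Y\to Y\times X$, $(X\times Y)\times Z\to X\times(Y\times Z)$ and $X\to 1\times X$; the injections $X\to X+Y$ and $Y\to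 X+Y$, the natural bijections $X+Y\to Y+X$ and $(X+Y)+Z\to X+(Y+Z)$, the codiagonal $X+X\to X$; and the distributivity map $X\times(Y+Z)\to X\times Y+X\times Z$. A function $f:X\to Y$ is definable if it belongs to the class defined in the same way, but with $\mathtt{copy}:\mathbb{A}\to\mathbb{A}\times\mathbb{A}$, $a\mapsto(a,a)$, as an additional basic function. For $k\in\mathbb{N}$, $f:X\to Y$ is $k$-fold-use if $f=g\circ\mathtt{copy}^k$ for some single-use $g:X^k\to Y$, where $\mathtt{copy}^k:X\to X^k$, $x\mapsto(x,\dots,x)$, $X^k=X\times(X\times\cdots\times X)$ ($k$ factors), $X^1=X$ and $X^0=1$. Then for all polynomial orbit-finite sets $X,Y$ and every function $f:X\to Y$: 1. $f$ is definable if and only if $f$ is finitely supported. 2. If $f$ is finitely supported, then $f$ is $k$-fold-use for some $k\ge 1$. Conversely, for every $k\in\mathbb{N}$, every $k$-fold-use function is finitely supported. -/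

import Mathlib

universe u

/-- Codes for polynomial orbit-finite sets: the smallest class containing the atomless singleton `1`
and the set of atoms, closed under binary products and binary disjoint sums. -/
inductive POF : Type where
  | one : POF
  | atom : POF
  | prod : POF → POF → POF
  | sum : POF → POF → POF

namespace POF

/-- The underlying set of a polynomial orbit-finite set over the set of atoms `𝔸`. -/
def El (𝔸 : Type u) : POF → Type u
  | one => PUnit
  | atom => 𝔸
  | prod X Y => El 𝔸 X × El 𝔸 Y
  | sum X Y => El 𝔸 X ⊕ El 𝔸 Y

/-- The action of atom permutations: trivial on `1`, the natural action on the atoms, componentwise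
on products and sums. -/
instance mulAction (𝔸 : Type u) : (X : POF) → MulAction (Equiv.Perm 𝔸) (X.El 𝔸)
  | one => inferInstanceAs (MulAction (Equiv.Perm 𝔸) PUnit)
  | atom => inferInstanceAs (MulAction (Equiv.Perm 𝔸) 𝔸)
  | prod X Y =>
    letI := mulAction 𝔸 X
    letI := mulAction 𝔸 Y
    inferInstanceAs (MulAction (Equiv.Perm 𝔸) (X.El 𝔸 × Y.El 𝔸))
  | sum X Y =>
    letI := mulAction 𝔸 X
    letI := mulAction 𝔸 Y
    inferInstanceAs (MulAction (Equiv.Perm 𝔸) (X.El 𝔸 ⊕ Y.El 𝔸))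

/-- The power `X ^ k = X × (X × ⋯ × X)` (bracketed to the right), with `X ^ 0 = 1` and
`X ^ 1 = X`. -/
def pow (X : POF) : ℕ → POF
  | 0 => one
  | 1 => X
  | k + 2 => prod X (pow X (k + 1))

/-- The function `copy ^ k : X → X ^ k`, `x ↦ (x, …, x)`. -/
def copyPow {𝔸 : Type u} (X : POF) : (k : ℕ) → X.El 𝔸 → (X.pow k).El 𝔸
  | 0 => fun _ => PUnit.unit
  | 1 => fun x => x
  | k + 2 => fun x => (x, copyPow X (k + 1) x)

end POF

open POF

/-- The action of an atom permutation on functions: `π(f) = π ∘ f ∘ π⁻¹`. -/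
def permFun {𝔸 : Type u} {X Y : POF} (π : Equiv.Perm 𝔸) (f : X.El 𝔸 → Y.El 𝔸) :
    X.El 𝔸 → Y.El 𝔸 :=
  fun x => π • f (π⁻¹ • x)

/-- `f : X →_fs Y`: some finite set `α` of atoms supports `f`, i.e. every atom permutation that fixes
all elements of `α` fixes `f`. -/
def IsFinitelySupported {𝔸 : Type u} {X Y : POF} (f : X.El 𝔸 → Y.El 𝔸) : Prop :=
  ∃ α : Finset 𝔸, ∀ π : Equiv.Perm 𝔸, (∀ a ∈ α, π a = a) → permFun π f = f

open Classical in
/-- The basic single-use functions. The truth values of `eq` are the elements of `1 + 1`, with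
`inl` for true. -/
inductive IsBasic {𝔸 : Type u} : {X Y : POF} → (X.El 𝔸 → Y.El 𝔸) → Prop
  | eq : IsBasic (X := prod atom atom) (Y := sum one one)
      (fun p : 𝔸 × 𝔸 => if p.1 = p.2 then Sum.inl PUnit.unit else Sum.inr PUnit.unit)
  | const (a : 𝔸) : IsBasic (X := one) (Y := atom) (fun _ => a)
  | id : IsBasic (X := atom) (Y := atom) (fun a => a)
  | proj₁ (X Y : POF) : IsBasic (X := prod X Y) (Y := X) (fun p : X.El 𝔸 × Y.El 𝔸 => p.1)
  | proj₂ (X Y : POF) : IsBasic (X := prod X Y) (Y := Y) (fun p : X.El 𝔸 × Y.El 𝔸 => p.2)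
  | sym (X Y : POF) : IsBasic (X := prod X Y) (Y := prod Y X)
      (fun p : X.El 𝔸 × Y.El 𝔸 => (p.2, p.1))
  | assoc (X Y Z : POF) : IsBasic (X := prod (prod X Y) Z) (Y := prod X (prod Y Z))
      (fun p : (X.El 𝔸 × Y.El 𝔸) × Z.El 𝔸 => (p.1.1, (p.1.2, p.2)))
  | leftI (X : POF) : IsBasic (X := X) (Y := prod one X) (fun x => (PUnit.unit, x))
  | coproj₁ (X Y : POF) : IsBasic (X := X) (Y := sum X Y) (fun x => Sum.inl x)
  | coproj₂ (X Y : POF) : IsBasic (X := Y) (Y := sum X Y) (fun y => Sum.inr y)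
  | cosym (X Y : POF) : IsBasic (X := sum X Y) (Y := sum Y X)
      (fun s : X.El 𝔸 ⊕ Y.El 𝔸 => Sum.elim Sum.inr Sum.inl s)
  | coassoc (X Y Z : POF) : IsBasic (X := sum (sum X Y) Z) (Y := sum X (sum Y Z))
      (fun s : (X.El 𝔸 ⊕ Y.El 𝔸) ⊕ Z.El 𝔸 =>
        Sum.elim (Sum.elim Sum.inl (fun y => Sum.inr (Sum.inl y)))
          (fun z => Sum.inr (Sum.inr z)) s)
  | merge (X : POF) : IsBasic (X := sum X X) (Y := X)
      (fun s : X.El 𝔸 ⊕ X.El 𝔸 => Sum.elim (fun x => x) (fun x => x) s)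
  | distr (X Y Z : POF) : IsBasic (X := prod X (sum Y Z)) (Y := sum (prod X Y) (prod X Z))
      (fun p : X.El 𝔸 × (Y.El 𝔸 ⊕ Z.El 𝔸) =>
        Sum.elim (fun y => Sum.inl (p.1, y)) (fun z => Sum.inr (p.1, z)) p.2)

/-- The function `copy : 𝔸 → 𝔸 × 𝔸`, `a ↦ (a, a)`, as a one-element class of functions. -/
inductive IsCopy {𝔸 : Type u} : {X Y : POF} → (X.El 𝔸 → Y.El 𝔸) → Prop
  | copy : IsCopy (X := atom) (Y := prod atom atom) (fun a : 𝔸 => (a, a))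

/-- The smallest class of functions between polynomial orbit-finite sets that contains the class `B`
and is closed under the combinators `g ∘ f`, `f × g` and `f + g`. -/
inductive Generated {𝔸 : Type u} (B : (X Y : POF) → (X.El 𝔸 → Y.El 𝔸) → Prop) :
    {X Y : POF} → (X.El 𝔸 → Y.El 𝔸) → Prop
  | basic {X Y : POF} {f : X.El 𝔸 → Y.El 𝔸} (hf : B X Y f) : Generated B f
  | comp {X Y Z : POF} {f : X.El 𝔸 → Y.El 𝔸} {g : Y.El 𝔸 → Z.El 𝔸}
      (hf : Generated B f) (hg : Generated B g) : Generated B (X := X) (Y := Z) (g ∘ f)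
  | prod {X₁ X₂ Y₁ Y₂ : POF} {f : X₁.El 𝔸 → Y₁.El 𝔸} {g : X₂.El 𝔸 → Y₂.El 𝔸}
      (hf : Generated B f) (hg : Generated B g) :
      Generated B (X := POF.prod X₁ X₂) (Y := POF.prod Y₁ Y₂) (Prod.map f g)
  | sum {X₁ X₂ Y₁ Y₂ : POF} {f : X₁.El 𝔸 → Y₁.El 𝔸} {g : X₂.El 𝔸 → Y₂.El 𝔸}
      (hf : Generated B f) (hg : Generated B g) :
      Generated B (X := POF.sum X₁ X₂) (Y := POF.sum Y₁ Y₂) (Sum.map f g)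

/-- Single-use functions `X ⊸ Y`. -/
def IsSingleUse {𝔸 : Type u} {X Y : POF} (f : X.El 𝔸 → Y.El 𝔸) : Prop :=
  Generated (fun _ _ h => IsBasic h) f

/-- Definable functions: `copy : 𝔸 → 𝔸 × 𝔸` is added to the basic single-use functions. -/
def IsDefinable {𝔸 : Type u} {X Y : POF} (f : X.El 𝔸 → Y.El 𝔸) : Prop :=
  Generated (fun _ _ h => IsBasic h ∨ IsCopy h) f

/-- `k`-fold-use functions: compositions of `copy ^ k : X → X ^ k` with a single-use function
`X ^ k ⊸ Y`. -/
def IsKFoldUse {𝔸 : Type u} {X Y : POF} (k : ℕ) (f : X.El 𝔸 → Y.El 𝔸) : Prop :=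
  ∃ g : (X.pow k).El 𝔸 → Y.El 𝔸, IsSingleUse g ∧ f = g ∘ X.copyPow k

/-! Basic functions have finite supports and the combinators preserve this. Conversely, let `α`
support `f` and contain two distinct atoms. Finitely many definable coordinates embed `X` into a
power of `𝔸`. The equality pattern of these coordinates and the atoms of `α` determines the orbit of
a point under the permutations fixing `α` (`exists_perm_apply_eq`). On one orbit `f` is determined
by a single value `f s`, whose atoms all occur among the coordinates of `s` and `α`, so `f` is
rebuilt from coordinates (`exists_isDefinable_smul_eq`). Finitely many equality tests glue the
orbits (`exists_isDefinable_eqOn`).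

For the `k`-fold form, all copying can be moved to the input: the multi-use functions contain `copy`
and are closed under the combinators (`IsDefinable.isMultiUse`). -/

variable {𝔸 : Type u} {X Y Z W : POF}

/-! ### Single-use functions -/

namespace IsSingleUse

theorem of_eq {f g : X.El 𝔸 → Y.El 𝔸} (hf : IsSingleUse f) (h : ∀ x, f x = g x) :
    IsSingleUse g :=
  (funext h : f = g) ▸ hf

theorem id : (X : POF) → IsSingleUse (fun x : X.El 𝔸 => x)
  | .one => .of_eq (.comp (.basic (.leftI .one)) (.basic (.proj₂ .one .one))) fun _ => rfl
  | .atom => .basic .id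
  | .prod X Y => .of_eq (.prod (id X) (id Y)) fun _ => rfl
  | .sum X Y => .of_eq (.sum (id X) (id Y)) fun s => by cases s <;> rfl

theorem toOne (X : POF) : IsSingleUse (X := X) (Y := .one) (𝔸 := 𝔸) fun _ => PUnit.unit :=
  .of_eq (.comp (.basic (.leftI X)) (.basic (.proj₁ .one X))) fun _ => rfl

theorem const (X : POF) : {Y : POF} → (y : Y.El 𝔸) → IsSingleUse (X := X) fun _ => y
  | .one, _ => toOne X
  | .atom, a => .of_eq (.comp (toOne X) (.basic (.const a))) fun _ => rfl
  | .prod Y Z, (y, z) => .of_eq (.comp (.basic (.leftI X))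
      (.prod (const .one (Y := Y) y) (const X (Y := Z) z))) fun _ => rfl
  | .sum _ Z, .inl y => .of_eq (.comp (const X y) (.basic (.coproj₁ _ Z))) fun _ => rfl
  | .sum Y _, .inr z => .of_eq (.comp (const X z) (.basic (.coproj₂ Y _))) fun _ => rfl

theorem sumElim {f : X.El 𝔸 → Z.El 𝔸} {g : Y.El 𝔸 → Z.El 𝔸} (hf : IsSingleUse f)
    (hg : IsSingleUse g) : IsSingleUse (X := .sum X Y) (Y := Z) (Sum.elim f g) :=
  .of_eq (.comp (.sum hf hg) (.basic (.merge Z))) fun s => by cases s <;> rfl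

/-- Symmetry followed by associativity rotates the three factors; repeating this and swapping once
more restores their order with the other bracketing. -/
theorem assocSymm (X Y Z : POF) :
    IsSingleUse (X := .prod X (.prod Y Z)) (Y := .prod (.prod X Y) Z)
      (fun p : X.El 𝔸 × (Y.El 𝔸 × Z.El 𝔸) => ((p.1, p.2.1), p.2.2)) :=
  .of_eq (.comp (.comp (.comp (.comp (.basic (.sym X (.prod Y Z))) (.basic (.assoc Y Z X)))
    (.basic (.sym Y (.prod Z X)))) (.basic (.assoc Z X Y))) (.basic (.sym Z (.prod X Y))))
    fun _ => rfl

theorem prodProdProdComm (X Y Z W : POF) :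
    IsSingleUse (X := .prod (.prod X Y) (.prod Z W)) (Y := .prod (.prod X Z) (.prod Y W))
      (fun p : (X.El 𝔸 × Y.El 𝔸) × (Z.El 𝔸 × W.El 𝔸) => ((p.1.1, p.2.1), (p.1.2, p.2.2))) :=
  .of_eq (.comp (.comp (.comp (.comp (.basic (.assoc X Y (.prod Z W)))
    (.prod (id X) (assocSymm Y Z W)))
    (.prod (id X) (.prod (.basic (.sym Y Z)) (id W))))
    (.prod (id X) (.basic (.assoc Z Y W)))) (assocSymm X Z (.prod Y W))) fun _ => rfl

/-- Selecting a component of a pair according to the summand of a sum. -/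
theorem select (X₁ X₂ Y : POF) :
    IsSingleUse (X := .prod (.prod Y Y) (.sum X₁ X₂)) (Y := Y)
      (fun p : (Y.El 𝔸 × Y.El 𝔸) × (X₁.El 𝔸 ⊕ X₂.El 𝔸) =>
        Sum.elim (fun _ => p.1.1) (fun _ => p.1.2) p.2) :=
  .of_eq (.comp (.basic (.distr (.prod Y Y) X₁ X₂))
    (sumElim (.comp (.basic (.proj₁ (.prod Y Y) X₁)) (.basic (.proj₁ Y Y)))
      (.comp (.basic (.proj₁ (.prod Y Y) X₂)) (.basic (.proj₂ Y Y)))))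
    fun p => by obtain ⟨_, s⟩ := p; cases s <;> rfl

theorem isDefinable {f : X.El 𝔸 → Y.El 𝔸} (hf : IsSingleUse f) : IsDefinable f := by
  induction hf with
  | basic h => exact .basic (.inl h)
  | comp _ _ ihf ihg => exact .comp ihf ihg
  | prod _ _ ihf ihg => exact .prod ihf ihg
  | sum _ _ ihf ihg => exact .sum ihf ihg

end IsSingleUse

theorem POF.nonempty_el [Nonempty 𝔸] : (X : POF) → Nonempty (X.El 𝔸)
  | .one => ⟨PUnit.unit⟩
  | .atom => ‹Nonempty 𝔸›
  | .prod X Y => (nonempty_el X).elim fun x => (nonempty_el Y).elim fun y => ⟨(x, y)⟩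
  | .sum X _ => (nonempty_el X).elim fun x => ⟨.inl x⟩

/-! ### Multiple-use functions -/

/-- Functions that are `k`-fold-use for some `k ≥ 1`. -/
def IsMultiUse (f : X.El 𝔸 → Y.El 𝔸) : Prop :=
  ∃ k : ℕ, IsKFoldUse (k + 1) f

namespace IsMultiUse

theorem of_eq {f g : X.El 𝔸 → Y.El 𝔸} (hf : IsMultiUse f) (h : ∀ x, f x = g x) :
    IsMultiUse g :=
  (funext h : f = g) ▸ hf

theorem of_isSingleUse {f : X.El 𝔸 → Y.El 𝔸} (hf : IsSingleUse f) : IsMultiUse f :=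
  ⟨0, f, hf, rfl⟩

theorem comp_isSingleUse {f : X.El 𝔸 → Y.El 𝔸} {g : Y.El 𝔸 → Z.El 𝔸} (hf : IsMultiUse f)
    (hg : IsSingleUse g) : IsMultiUse (g ∘ f) := by
  obtain ⟨k, h, hh, rfl⟩ := hf
  exact ⟨k, g ∘ h, .comp hh hg, rfl⟩

theorem copyPow_prod (X : POF) : (m n : ℕ) →
    IsMultiUse (𝔸 := 𝔸) (X := X) (Y := .prod (X.pow (m + 1)) (X.pow (n + 1)))
      (fun x => (X.copyPow (m + 1) x, X.copyPow (n + 1) x))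
  -- `X × X ^ (n + 1)` is `X ^ (n + 2)` by definition.
  | 0, n => ⟨n + 1, fun p => p, IsSingleUse.id _, rfl⟩
  | m + 1, n => by
    obtain ⟨k, h, hh, e⟩ := copyPow_prod X m n
    refine ⟨k + 1, _, Generated.comp (Generated.prod (IsSingleUse.id X) hh)
      (IsSingleUse.assocSymm X (X.pow (m + 1)) (X.pow (n + 1))), funext fun x => ?_⟩
    have ex : h (X.copyPow (k + 1) x) = (X.copyPow (m + 1) x, X.copyPow (n + 1) x) :=
      (congrFun e x).symm
    change _ = ((x, (h (X.copyPow (k + 1) x)).1), (h (X.copyPow (k + 1) x)).2)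
    rw [ex]
    rfl

theorem pair {f : X.El 𝔸 → Y.El 𝔸} {g : X.El 𝔸 → Z.El 𝔸} (hf : IsMultiUse f)
    (hg : IsMultiUse g) : IsMultiUse (X := X) (Y := .prod Y Z) (fun x => (f x, g x)) := by
  obtain ⟨m, f', hf', rfl⟩ := hf
  obtain ⟨n, g', hg', rfl⟩ := hg
  exact (copyPow_prod X m n).comp_isSingleUse (.prod hf' hg')

theorem comp {f : X.El 𝔸 → Y.El 𝔸} {g : Y.El 𝔸 → Z.El 𝔸} (hf : IsMultiUse f)
    (hg : IsMultiUse g) : IsMultiUse (g ∘ f) := by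
  obtain ⟨n, h, hh, rfl⟩ := hg
  -- Instead of copying the output of `f`, run `f` on several copies of the input.
  have key : ∀ n, IsMultiUse (Y.copyPow (n + 1) ∘ f) := by
    intro n
    induction n with
    | zero => exact hf
    | succ n ih => exact hf.pair ih
  exact (key n).comp_isSingleUse hh

theorem prodMap {X₁ X₂ Y₁ Y₂ : POF} {f : X₁.El 𝔸 → Y₁.El 𝔸} {g : X₂.El 𝔸 → Y₂.El 𝔸}
    (hf : IsMultiUse f) (hg : IsMultiUse g) :
    IsMultiUse (X := .prod X₁ X₂) (Y := .prod Y₁ Y₂) (Prod.map f g) :=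
  .of_eq (pair (comp (of_isSingleUse (.basic (.proj₁ X₁ X₂))) hf)
    (comp (of_isSingleUse (.basic (.proj₂ X₁ X₂))) hg)) fun _ => rfl

/-- Both branches are run, the wrong one on a default value, and a further copy of the input selects
the right result. -/
theorem sumMap [Nonempty 𝔸] {X₁ X₂ Y₁ Y₂ : POF} {f : X₁.El 𝔸 → Y₁.El 𝔸}
    {g : X₂.El 𝔸 → Y₂.El 𝔸} (hf : IsMultiUse f) (hg : IsMultiUse g) :
    IsMultiUse (X := .sum X₁ X₂) (Y := .sum Y₁ Y₂) (Sum.map f g) := by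
  obtain ⟨x₁⟩ := X₁.nonempty_el (𝔸 := 𝔸)
  obtain ⟨x₂⟩ := X₂.nonempty_el (𝔸 := 𝔸)
  refine .of_eq (comp_isSingleUse
    (pair (X := .sum X₁ X₂) (pair
      (comp (comp (of_isSingleUse ((IsSingleUse.id X₁).sumElim (.const X₂ x₁))) hf)
        (of_isSingleUse (.basic (.coproj₁ Y₁ Y₂))))
      (comp (comp (of_isSingleUse (IsSingleUse.sumElim (.const X₁ x₂) (.id X₂))) hg)
        (of_isSingleUse (.basic (.coproj₂ Y₁ Y₂)))))
      (of_isSingleUse (.id (.sum X₁ X₂))))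
    (.select X₁ X₂ (.sum Y₁ Y₂))) fun s => by cases s <;> rfl

end IsMultiUse

theorem IsDefinable.isMultiUse [Nonempty 𝔸] {f : X.El 𝔸 → Y.El 𝔸} (hf : IsDefinable f) :
    IsMultiUse f := by
  induction hf with
  | basic h =>
    rcases h with h | h
    · exact .of_isSingleUse (.basic h)
    · cases h
      exact ⟨1, fun p => p, IsSingleUse.id (.prod .atom .atom), rfl⟩
  | comp _ _ ihf ihg => exact ihf.comp ihg
  | prod _ _ ihf ihg => exact ihf.prodMap ihg
  | sum _ _ ihf ihg => exact ihf.sumMap ihg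

/-! ### Definable functions are finitely supported -/

/-- `f` commutes with every atom permutation that fixes `α` pointwise. -/
def SupportedBy (α : Set 𝔸) (f : X.El 𝔸 → Y.El 𝔸) : Prop :=
  ∀ π : Equiv.Perm 𝔸, (∀ a ∈ α, π a = a) → ∀ x, f (π • x) = π • f x

theorem SupportedBy.mono {α β : Set 𝔸} {f : X.El 𝔸 → Y.El 𝔸} (hf : SupportedBy α f)
    (h : α ⊆ β) : SupportedBy β f :=
  fun π hπ => hf π fun a ha => hπ a (h ha)

theorem isFinitelySupported_iff {f : X.El 𝔸 → Y.El 𝔸} :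
    IsFinitelySupported f ↔ ∃ α : Set 𝔸, α.Finite ∧ SupportedBy α f := by
  constructor
  · rintro ⟨α, h⟩
    refine ⟨α, α.finite_toSet, fun π hπ x => ?_⟩
    have := congrFun (h π hπ) (π • x)
    simpa [permFun] using this.symm
  · rintro ⟨α, hα, h⟩
    refine ⟨hα.toFinset, fun π hπ => funext fun x => ?_⟩
    rw [permFun, ← h π (by simpa using hπ), smul_inv_smul]

namespace IsFinitelySupported

theorem of_equivariant {f : X.El 𝔸 → Y.El 𝔸} (h : ∀ (π : Equiv.Perm 𝔸) x, f (π • x) = π • f x) :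
    IsFinitelySupported f :=
  isFinitelySupported_iff.2 ⟨∅, Set.finite_empty, fun π _ => h π⟩

theorem comp {f : X.El 𝔸 → Y.El 𝔸} {g : Y.El 𝔸 → Z.El 𝔸} (hf : IsFinitelySupported f)
    (hg : IsFinitelySupported g) : IsFinitelySupported (g ∘ f) := by
  obtain ⟨α, hα, hf⟩ := isFinitelySupported_iff.1 hf
  obtain ⟨β, hβ, hg⟩ := isFinitelySupported_iff.1 hg
  refine isFinitelySupported_iff.2 ?_
  refine ⟨α ∪ β, hα.union hβ, fun π hπ x => ?_⟩
  rw [Function.comp, hf π fun a ha => hπ a (.inl ha), hg π fun a ha => hπ a (.inr ha)]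
  rfl

theorem prodMap {X₁ X₂ Y₁ Y₂ : POF} {f : X₁.El 𝔸 → Y₁.El 𝔸} {g : X₂.El 𝔸 → Y₂.El 𝔸}
    (hf : IsFinitelySupported f) (hg : IsFinitelySupported g) :
    IsFinitelySupported (X := .prod X₁ X₂) (Y := .prod Y₁ Y₂) (Prod.map f g) := by
  obtain ⟨α, hα, hf⟩ := isFinitelySupported_iff.1 hf
  obtain ⟨β, hβ, hg⟩ := isFinitelySupported_iff.1 hg
  refine isFinitelySupported_iff.2 ?_
  exact ⟨α ∪ β, hα.union hβ, fun π hπ x => Prod.ext (hf π (fun a ha => hπ a (.inl ha)) x.1)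
    (hg π (fun a ha => hπ a (.inr ha)) x.2)⟩

theorem sumMap {X₁ X₂ Y₁ Y₂ : POF} {f : X₁.El 𝔸 → Y₁.El 𝔸} {g : X₂.El 𝔸 → Y₂.El 𝔸}
    (hf : IsFinitelySupported f) (hg : IsFinitelySupported g) :
    IsFinitelySupported (X := .sum X₁ X₂) (Y := .sum Y₁ Y₂) (Sum.map f g) := by
  obtain ⟨α, hα, hf⟩ := isFinitelySupported_iff.1 hf
  obtain ⟨β, hβ, hg⟩ := isFinitelySupported_iff.1 hg
  refine isFinitelySupported_iff.2 ?_
  refine ⟨α ∪ β, hα.union hβ, fun π hπ x => ?_⟩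
  rcases x with x | x
  · exact congrArg Sum.inl (hf π (fun a ha => hπ a (.inl ha)) x)
  · exact congrArg Sum.inr (hg π (fun a ha => hπ a (.inr ha)) x)

theorem copyPow (X : POF) (k : ℕ) : IsFinitelySupported (𝔸 := 𝔸) (X.copyPow k) := by
  refine of_equivariant fun π x => ?_
  induction k using Nat.twoStepInduction with
  | zero => rfl
  | one => rfl
  | more k _ ih => exact Prod.ext rfl ih

end IsFinitelySupported

theorem IsBasic.isFinitelySupported {f : X.El 𝔸 → Y.El 𝔸} (hf : IsBasic f) :
    IsFinitelySupported f := by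
  cases hf with
  | eq =>
    refine .of_equivariant fun π p => ?_
    by_cases h : p.1 = p.2
    · exact (if_pos (congrArg π h)).trans
        (congrArg (fun s : (POF.sum .one .one).El 𝔸 => π • s)
          (if_pos h : _ = Sum.inl PUnit.unit).symm)
    · exact (if_neg (π.injective.ne h)).trans
        (congrArg (fun s : (POF.sum .one .one).El 𝔸 => π • s)
          (if_neg h : _ = Sum.inr PUnit.unit).symm)
  | const a =>
    exact isFinitelySupported_iff.2 ⟨{a}, Set.finite_singleton a, fun π hπ _ => (hπ a rfl).symm⟩
  | cosym | merge => exact .of_equivariant fun π s => by rcases s with s | s <;> rfl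
  | coassoc => exact .of_equivariant fun π s => by rcases s with (s | s) | s <;> rfl
  | distr => exact .of_equivariant fun π p => by rcases p with ⟨x, s | s⟩ <;> rfl
  | _ => exact .of_equivariant fun π _ => rfl

theorem IsDefinable.isFinitelySupported {f : X.El 𝔸 → Y.El 𝔸} (hf : IsDefinable f) :
    IsFinitelySupported f := by
  induction hf with
  | basic h =>
    rcases h with h | h
    · exact h.isFinitelySupported
    · cases h
      exact .of_equivariant fun _ _ => rfl
  | comp _ _ ihf ihg => exact ihf.comp ihg
  | prod _ _ ihf ihg => exact ihf.prodMap ihg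
  | sum _ _ ihf ihg => exact ihf.sumMap ihg

/-! ### Finitely supported functions are definable -/

namespace IsDefinable

theorem of_eq {f g : X.El 𝔸 → Y.El 𝔸} (hf : IsDefinable f) (h : ∀ x, f x = g x) :
    IsDefinable g :=
  (funext h : f = g) ▸ hf

/-- Copying atoms suffices to copy elements of every `X`, by recursion on its code. -/
theorem diag : (X : POF) → IsDefinable (X := X) (Y := .prod X X) (fun x : X.El 𝔸 => (x, x))
  | .one => .of_eq (IsSingleUse.isDefinable (.basic (.leftI .one))) fun _ => rfl
  | .atom => .basic (.inr .copy)
  | .prod X Y => .of_eq (.comp (.prod (diag X) (diag Y))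
      (IsSingleUse.prodProdProdComm X X Y Y).isDefinable) fun _ => rfl
  | .sum X Y => .of_eq (.comp (.sum (diag X) (diag Y)) (IsSingleUse.isDefinable
      (.sumElim (Z := .prod (.sum X Y) (.sum X Y))
        (.prod (.basic (.coproj₁ X Y)) (.basic (.coproj₁ X Y)))
        (.prod (.basic (.coproj₂ X Y)) (.basic (.coproj₂ X Y))))))
      fun s => by cases s <;> rfl

theorem pair {f : X.El 𝔸 → Y.El 𝔸} {g : X.El 𝔸 → Z.El 𝔸} (hf : IsDefinable f)
    (hg : IsDefinable g) : IsDefinable (X := X) (Y := .prod Y Z) (fun x => (f x, g x)) :=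
  .of_eq (.comp (diag X) (.prod hf hg)) fun _ => rfl

theorem sumElim {f : X.El 𝔸 → Z.El 𝔸} {g : Y.El 𝔸 → Z.El 𝔸} (hf : IsDefinable f)
    (hg : IsDefinable g) : IsDefinable (X := .sum X Y) (Y := Z) (Sum.elim f g) :=
  .of_eq (.comp (.sum hf hg) (IsSingleUse.isDefinable (.basic (.merge Z))))
    fun s => by cases s <;> rfl

open Classical in
theorem ite_eq {t u : X.El 𝔸 → 𝔸} {f g : X.El 𝔸 → Y.El 𝔸} (ht : IsDefinable (Y := .atom) t)
    (hu : IsDefinable (Y := .atom) u) (hf : IsDefinable f) (hg : IsDefinable g) :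
    IsDefinable (fun x => if t x = u x then f x else g x) := by
  refine .of_eq (.comp (pair (pair hf hg) (.comp (pair ht hu) (.basic (.inl .eq))))
    (IsSingleUse.select .one .one Y).isDefinable) fun x => ?_
  change Sum.elim (fun _ => f x) (fun _ => g x) (if t x = u x then Sum.inl PUnit.unit else
    Sum.inr PUnit.unit : PUnit ⊕ PUnit) = _
  by_cases h : t x = u x <;> simp [h]

end IsDefinable

/-- A function that agrees with a definable one on every class of a partition of `D` given by
finitely many equality tests agrees with a definable function on `D`. -/
theorem exists_isDefinable_eqOn [Nonempty 𝔸] {f : X.El 𝔸 → Y.El 𝔸}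
    {P : Set ((X.El 𝔸 → 𝔸) × (X.El 𝔸 → 𝔸))} (hP : P.Finite)
    (hdef : ∀ p ∈ P, IsDefinable (Y := .atom) p.1 ∧ IsDefinable (Y := .atom) p.2)
    (D : Set (X.El 𝔸))
    (h : ∀ s ∈ D, ∃ g : X.El 𝔸 → Y.El 𝔸, IsDefinable g ∧
      ∀ x ∈ D, (∀ p ∈ P, p.1 x = p.2 x ↔ p.1 s = p.2 s) → g x = f x) :
    ∃ g : X.El 𝔸 → Y.El 𝔸, IsDefinable g ∧ ∀ x ∈ D, g x = f x := by
  classical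
  induction P, hP using Set.Finite.induction_on generalizing D with
  | empty =>
    rcases D.eq_empty_or_nonempty with rfl | ⟨s, hs⟩
    · obtain ⟨y⟩ := Y.nonempty_el (𝔸 := 𝔸)
      exact ⟨_, (IsSingleUse.const X y).isDefinable, by simp⟩
    · simpa using h s hs
  | @insert q P _ _ ih =>
    -- Restricting `D` to one outcome of the test `q` makes the condition at `q` automatic.
    have split : ∀ c : Prop, ∃ g : X.El 𝔸 → Y.El 𝔸, IsDefinable g ∧
        ∀ x ∈ {x ∈ D | q.1 x = q.2 x ↔ c}, g x = f x := by
      refine fun c => ih (fun p hp => hdef p (.inr hp)) _ fun s hs => ?_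
      obtain ⟨g, hg, hgf⟩ := h s hs.1
      refine ⟨g, hg, fun x hx hxs => hgf x hx.1 ?_⟩
      rintro p (rfl | hp)
      · exact hx.2.trans hs.2.symm
      · exact hxs p hp
    obtain ⟨g₁, hg₁, e₁⟩ := split True
    obtain ⟨g₂, hg₂, e₂⟩ := split False
    refine ⟨_, .ite_eq (hdef q (.inl rfl)).1 (hdef q (.inl rfl)).2 hg₁ hg₂, fun x hx => ?_⟩
    by_cases hq : q.1 x = q.2 x
    · simpa [hq] using e₁ x ⟨hx, by simpa using hq⟩
    · simpa [hq] using e₂ x ⟨hx, by simpa using hq⟩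

/-- Every polynomial orbit-finite set embeds into a finite power of the atoms by definable
functions. -/
theorem exists_atom_coordinates {a₀ a₁ : 𝔸} (ha : a₀ ≠ a₁) (X : POF) :
    ∃ T : Set (X.El 𝔸 → 𝔸), T.Finite ∧ (∀ t ∈ T, IsDefinable (Y := .atom) t) ∧
      (∀ t ∈ T, SupportedBy (Y := .atom) {a₀, a₁} t) ∧
      ∀ x y, (∀ t ∈ T, t x = t y) → x = y := by
  induction X with
  | one => exact ⟨∅, Set.finite_empty, by simp, by simp, fun _ _ _ => rfl⟩
  | atom =>
    exact ⟨{fun a => a}, Set.finite_singleton _, by rintro _ rfl; exact .basic (.inl .id),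
      by rintro _ rfl π _ a; rfl, fun x y h => h _ rfl⟩
  | prod X Y ihX ihY =>
    obtain ⟨T, hT, dT, sT, iT⟩ := ihX
    obtain ⟨U, hU, dU, sU, iU⟩ := ihY
    refine ⟨(fun t p => t p.1) '' T ∪ (fun u p => u p.2) '' U, (hT.image _).union (hU.image _),
      ?_, ?_, ?_⟩
    · rintro _ (⟨t, ht, rfl⟩ | ⟨u, hu, rfl⟩)
      · exact .of_eq (.comp (IsSingleUse.isDefinable (.basic (.proj₁ X Y))) (dT t ht)) fun _ => rfl
      · exact .of_eq (.comp (IsSingleUse.isDefinable (.basic (.proj₂ X Y))) (dU u hu)) fun _ => rfl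
    · rintro _ (⟨t, ht, rfl⟩ | ⟨u, hu, rfl⟩) π hπ p
      · exact sT t ht π hπ p.1
      · exact sU u hu π hπ p.2
    · exact fun p q h => Prod.ext (iT _ _ fun t ht => h _ (.inl ⟨t, ht, rfl⟩))
        (iU _ _ fun u hu => h _ (.inr ⟨u, hu, rfl⟩))
  | sum X Y ihX ihY =>
    obtain ⟨T, hT, dT, sT, iT⟩ := ihX
    obtain ⟨U, hU, dU, sU, iU⟩ := ihY
    -- The first coordinate records the summand; the others take the default `a₀` on the wrong
    -- summand.
    refine ⟨{Sum.elim (fun _ => a₀) (fun _ => a₁)} ∪ ((fun t => Sum.elim t fun _ => a₀) '' T ∪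
      (fun u => Sum.elim (fun _ => a₀) u) '' U),
      (Set.finite_singleton _).union ((hT.image _).union (hU.image _)), ?_, ?_, ?_⟩
    · have hc (Z : POF) (a : 𝔸) : IsDefinable (X := Z) (Y := .atom) fun _ => a :=
        (IsSingleUse.const Z (Y := .atom) a).isDefinable
      rintro _ (rfl | ⟨t, ht, rfl⟩ | ⟨u, hu, rfl⟩)
      · exact (hc X a₀).sumElim (hc Y a₁)
      · exact (dT t ht).sumElim (hc Y a₀)
      · exact (hc X a₀).sumElim (dU u hu)
    · rintro _ (rfl | ⟨t, ht, rfl⟩ | ⟨u, hu, rfl⟩) π hπ (x | y)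
      · exact (hπ a₀ (.inl rfl)).symm
      · exact (hπ a₁ (.inr rfl)).symm
      · exact sT t ht π hπ x
      · exact (hπ a₀ (.inl rfl)).symm
      · exact (hπ a₀ (.inl rfl)).symm
      · exact sU u hu π hπ y
    · rintro (x | x) (y | y) h
      · exact congrArg Sum.inl (iT _ _ fun t ht => h _ (.inr (.inl ⟨t, ht, rfl⟩)))
      · exact absurd (h _ (.inl rfl)) ha
      · exact absurd (h _ (.inl rfl)) ha.symm
      · exact congrArg Sum.inr (iU _ _ fun u hu => h _ (.inr (.inr ⟨u, hu, rfl⟩)))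

/-- Two finite tuples with the same equality type are related by a permutation. -/
theorem exists_perm_apply_eq {ι α : Type*} [Finite ι] (u v : ι → α)
    (h : ∀ i j, u i = u j ↔ v i = v j) : ∃ π : Equiv.Perm α, ∀ i, π (u i) = v i := by
  obtain ⟨π, hπ⟩ := Equiv.Perm.exists_extending_pair (Subtype.val : Set.range u → α)
    (v ∘ Set.rangeSplitting u) Subtype.val_injective fun a b hab =>
      Subtype.ext <| by
        simpa [Set.apply_rangeSplitting] using (h _ _).2 hab
  exact ⟨π, fun i => (hπ ⟨u i, i, rfl⟩).trans ((h _ _).1 (Set.apply_rangeSplitting u _))⟩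

/-- If `y` is fixed by the permutations fixing the coordinates of `s`, then some definable function
maps every translate `π • s` to `π • y`. -/
theorem exists_isDefinable_smul_eq [Infinite 𝔸] {α : Set 𝔸} {T : Set (X.El 𝔸 → 𝔸)} (hT : T.Finite)
    (dT : ∀ t ∈ T, IsDefinable (Y := .atom) t) (sT : ∀ t ∈ T, SupportedBy (Y := .atom) α t)
    (s : X.El 𝔸) (y : Y.El 𝔸)
    (hy : ∀ π : Equiv.Perm 𝔸, (∀ t ∈ T, π (t s) = t s) → π • y = y) :
    ∃ g : X.El 𝔸 → Y.El 𝔸, IsDefinable g ∧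
      ∀ π : Equiv.Perm 𝔸, (∀ a ∈ α, π a = a) → g (π • s) = π • y := by
  classical
  induction Y with
  | one => exact ⟨_, (IsSingleUse.toOne X).isDefinable, fun _ _ => rfl⟩
  | atom =>
    by_cases hys : ∃ t ∈ T, t s = y
    · obtain ⟨t, ht, rfl⟩ := hys
      exact ⟨t, dT t ht, fun π hπ => sT t ht π hπ s⟩
    · push Not at hys
      -- Swapping `y` with a fresh atom `b` would fix every coordinate but move `y`.
      obtain ⟨b, hb⟩ := Set.Finite.exists_notMem (α := 𝔸) ((hT.image fun t => t s).insert y)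
      refine absurd (hy (Equiv.swap y b) fun t ht => Equiv.swap_apply_of_ne_of_ne (hys t ht) ?_) ?_
      · rintro rfl
        exact hb (.inr ⟨t, ht, rfl⟩)
      · intro e
        exact hb (.inl ((Equiv.swap_apply_left (y : 𝔸) b).symm.trans e))
  | prod Y Z ihY ihZ =>
    obtain ⟨g, hg, eg⟩ := ihY y.1 fun π hπ => congrArg Prod.fst (hy π hπ)
    obtain ⟨h, hh, eh⟩ := ihZ y.2 fun π hπ => congrArg Prod.snd (hy π hπ)
    exact ⟨_, hg.pair hh, fun π hπ => Prod.ext (eg π hπ) (eh π hπ)⟩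
  | sum Y Z ihY ihZ =>
    rcases y with y | y
    · obtain ⟨g, hg, eg⟩ := ihY y fun π hπ => Sum.inl_injective (hy π hπ)
      exact ⟨_, .comp hg (IsSingleUse.isDefinable (.basic (.coproj₁ Y Z))),
        fun π hπ => congrArg Sum.inl (eg π hπ)⟩
    · obtain ⟨g, hg, eg⟩ := ihZ y fun π hπ => Sum.inr_injective (hy π hπ)
      exact ⟨_, .comp hg (IsSingleUse.isDefinable (.basic (.coproj₂ Y Z))),
        fun π hπ => congrArg Sum.inr (eg π hπ)⟩

theorem IsFinitelySupported.isDefinable [Infinite 𝔸] {f : X.El 𝔸 → Y.El 𝔸}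
    (hf : IsFinitelySupported f) : IsDefinable f := by
  obtain ⟨β, hβ, hf⟩ := isFinitelySupported_iff.1 hf
  obtain ⟨a₀, a₁, ha⟩ := exists_pair_ne 𝔸
  obtain ⟨T₀, hT₀, dT₀, sT₀, iT₀⟩ := exists_atom_coordinates ha X
  set α : Set 𝔸 := {a₀, a₁} ∪ β with hα
  -- With the constants from `α` as coordinates, a permutation matching coordinates must fix `α`.
  set T : Set (X.El 𝔸 → 𝔸) := T₀ ∪ (fun a _ => a) '' α with hTdef
  have hT : T.Finite := hT₀.union (((Set.toFinite _).union hβ).image _)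
  have dT : ∀ t ∈ T, IsDefinable (Y := .atom) t := by
    rintro _ (ht | ⟨a, _, rfl⟩)
    · exact dT₀ _ ht
    · exact (IsSingleUse.const X (Y := .atom) a).isDefinable
  have sT : ∀ t ∈ T, SupportedBy (Y := .atom) α t := by
    rintro _ (ht | ⟨a, ha, rfl⟩)
    · exact (sT₀ _ ht).mono Set.subset_union_left
    · exact fun π hπ _ => (hπ a ha).symm
  have cT : ∀ {s x} {π : Equiv.Perm 𝔸}, (∀ t ∈ T, π (t s) = t x) →
      (∀ a ∈ α, π a = a) ∧ π • s = x := by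
    intro s x π h
    have hπ : ∀ a ∈ α, π a = a := fun a ha => h (fun _ => a) (.inr ⟨a, ha, rfl⟩)
    exact ⟨hπ, iT₀ _ _ fun t ht => (sT t (.inl ht) π hπ s).trans (h t (.inl ht))⟩
  have hfα : SupportedBy α f := hf.mono Set.subset_union_right
  obtain ⟨g, hg, e⟩ := exists_isDefinable_eqOn (f := f) (hT.prod hT)
    (fun p hp => ⟨dT _ hp.1, dT _ hp.2⟩) Set.univ fun s _ => by
      obtain ⟨g, hg, eg⟩ := exists_isDefinable_smul_eq hT dT sT s (f s) fun π hπ => by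
        obtain ⟨h₁, h₂⟩ := cT hπ
        rw [← hfα π h₁, h₂]
      refine ⟨g, hg, fun x _ hx => ?_⟩
      have := hT.to_subtype
      obtain ⟨π, hπ⟩ := exists_perm_apply_eq (fun t : T => t.1 s) (fun t : T => t.1 x)
        fun t u => (hx (t.1, u.1) ⟨t.2, u.2⟩).symm
      obtain ⟨h₁, rfl⟩ := cT (fun t ht => hπ ⟨t, ht⟩)
      rw [eg π h₁, hfα π h₁]
  exact hg.of_eq fun x => e x trivial


theorem mainTheorem11 {𝔸 : Type*} [Countable 𝔸] [Infinite 𝔸] (X Y : POF)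
    (f : X.El 𝔸 → Y.El 𝔸) :
    (IsDefinable f ↔ IsFinitelySupported f) ∧
      (IsFinitelySupported f → ∃ k : ℕ, 1 ≤ k ∧ IsKFoldUse k f) ∧
      (∀ k : ℕ, IsKFoldUse k f → IsFinitelySupported f) := by
  refine ⟨⟨fun h => h.isFinitelySupported, fun h => h.isDefinable⟩, fun h => ?_, ?_⟩
  · obtain ⟨k, hk⟩ := h.isDefinable.isMultiUse
    exact ⟨k + 1, by omega, hk⟩
  · rintro k ⟨g, hg, rfl⟩
    exact (IsFinitelySupported.copyPow X k).comp hg.isDefinable.isFinitelySupported
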